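/- Let $m,n\ge 1$ be integers, and let $\Omega=\{1,\dots,m\}^{\mathbb N}$ be equipped with the metric $d(x,y)=2^{-k}$ for $x\neq y$, where $k=\min\{i\ge 1: x_i\neq y_i\}$, and $d(x,x)=0$. Let $\mathcal M$ be the space of Borel probabilities on $\Omega$ with the Monge–Kantorovich metric $$d_{MK}(\mu,\nu)=\sup\Big\{\int f\,d\mu-\int f\,d\nu \;:\; f:\Omega\to\mathbb R,\ \mathrm{Lip}(f)\le 1\Big\}.$$ Let $\mathfrak T(\nu)$ be the push-forward of $\nu\in\mathcal M$ under the shift $\sigma(x_1,x_2,\dots)=(x_2,x_3,\dots)$. For $\eta,\mu\in\mathcal M$ let $\eta *_n\mu\in\mathcal M$ be the image of $\eta\times\mu$ under $R_n(x,y)=(x_1,\dots,x_n,y_1,y_2,\dots)$, and put $\phi_\nu(\mu)=\mathfrak T(\nu)*_n\mu$. Let $A:\mathcal M\to\mathbb R$ be Lipschitz for $d_{MK}$, let $\Pi_0$ be a Borel probability on $\mathcal M$, and let $B_{\Pi_0}$ be the bounded operator on the space $C(\mathcal M,\mathbb R)$ of continuous functions with the supremum norm given by $$B_{\Pi_0}(F)(\mu)=\int_{\mathcal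 M}e^{A(\phi_\nu(\mu))}F(\phi_\nu(\mu))\,d\Pi_0(\nu).$$ Then there are a continuous function $h:\mathcal M\to\mathbb R$ with $h(\mu)>0$ for all $\mu\in\mathcal M$ and a number $\lambda>0$ such that $B_{\Pi_0}(h)=\lambda h$, and $\lambda$ is the spectral radius of $B_{\Pi_0}$: it is both the supremum of $|t|$ over the real spectral values $t$ of $B_{\Pi_0}$ and the limit $\lim_{N\to\infty}\|B_{\Pi_0}^N\|^{1/N}$. -/

import Mathlib

open MeasureTheory Filter Topology
open scoped NNReal ENNReal

noncomputable section

/-! ### The symbolic space -/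

/-- The symbolic space of one-sided sequences over an alphabet with `m` letters; the coordinate
`x i` is the letter usually written `x_{i+1}`. -/
def Symb (m : ℕ) : Type := ℕ → Fin m

namespace Symb

variable {m : ℕ}

instance : TopologicalSpace (Symb m) := inferInstanceAs (TopologicalSpace (ℕ → Fin m))

instance : CompactSpace (Symb m) := inferInstanceAs (CompactSpace (ℕ → Fin m))

open Classical in
/-- The distance is `0` on the diagonal, and `(1/2)^k` where `k ≥ 1` is the position (counted
from one) of the first letter where the two sequences differ. -/
def symbDist (x y : Symb m) : ℝ :=
  if x = y then 0 else (1 / 2 : ℝ) ^ (sInf {i : ℕ | x i ≠ y i} + 1)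

theorem symbDist_eq (x y : Symb m) :
    symbDist x y = (PiNat.dist (E := fun _ : ℕ => Fin m)).dist x y / 2 := by
  unfold symbDist
  split_ifs with h
  · subst h
    have := PiNat.dist_self (E := fun _ => Fin m) x
    linarith
  · rw [PiNat.dist_eq_of_ne (E := fun _ => Fin m) h, pow_succ]
    have hex : ∃ i, x i ≠ y i := by
      by_contra hc
      push Not at hc
      exact h (funext hc)
    have h1 : sInf {i : ℕ | x i ≠ y i} = PiNat.firstDiff (E := fun _ => Fin m) x y := by
      apply le_antisymm
      · exact Nat.sInf_le (PiNat.apply_firstDiff_ne (E := fun _ => Fin m) h)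
      · by_contra hlt
        exact (Nat.sInf_mem (s := {i : ℕ | x i ≠ y i}) hex)
          (PiNat.apply_eq_of_lt_firstDiff (E := fun _ => Fin m) (not_le.1 hlt))
    rw [h1]
    ring

theorem isOpen_iff_symbDist (s : Set (Symb m)) :
    IsOpen s ↔ ∀ x ∈ s, ∃ ε > 0, ∀ y, symbDist x y < ε → y ∈ s := by
  have key : IsOpen s ↔ ∀ x ∈ s, ∃ ε > 0, ∀ y : Symb m,
      (PiNat.dist (E := fun _ : ℕ => Fin m)).dist x y < ε → y ∈ s :=
    PiNat.isOpen_iff_dist (E := fun _ => Fin m) s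
  rw [key]
  constructor
  · intro h x hx
    obtain ⟨ε, hε, H⟩ := h x hx
    refine ⟨ε / 2, by positivity, fun y hy => H y ?_⟩
    rw [symbDist_eq] at hy
    linarith
  · intro h x hx
    obtain ⟨ε, hε, H⟩ := h x hx
    refine ⟨ε * 2, by positivity, fun y hy => H y ?_⟩
    rw [symbDist_eq]
    linarith

/-- The metric space structure given by `symbDist`; its topology is the product topology. -/
instance : MetricSpace (Symb m) :=
  MetricSpace.ofDistTopology symbDist
    (fun x => by simp [symbDist])
    (fun x y => by
      have := PiNat.dist_comm (E := fun _ => Fin m) x y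
      rw [symbDist_eq, symbDist_eq]
      linarith)
    (fun x y z => by
      have := PiNat.dist_triangle (E := fun _ => Fin m) x y z
      rw [symbDist_eq, symbDist_eq, symbDist_eq]
      linarith)
    isOpen_iff_symbDist
    (fun x y h => by
      rw [symbDist_eq] at h
      exact PiNat.eq_of_dist_eq_zero (E := fun _ => Fin m) x y (by linarith))

theorem dist_def (x y : Symb m) : dist x y = symbDist x y := rfl

instance : MeasurableSpace (Symb m) := borel (Symb m)

instance : BorelSpace (Symb m) := ⟨rfl⟩

theorem dist_le_one (x y : Symb m) : dist x y ≤ 1 := by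
  rw [dist_def, symbDist_eq]
  have := PiNat.dist_le_one (E := fun _ => Fin m) x y
  linarith

theorem dist_le_pow {x y : Symb m} {N : ℕ} (h : ∀ i < N, x i = y i) :
    dist x y ≤ (1 / 2 : ℝ) ^ N := by
  rw [dist_def, symbDist_eq]
  have := PiNat.mem_cylinder_iff_dist_le (E := fun _ => Fin m) (x := y) (y := x) (n := N) |>.1 h
  have h0 : (0 : ℝ) ≤ (1 / 2 : ℝ) ^ N := by positivity
  linarith

theorem continuous_apply (i : ℕ) : Continuous fun x : Symb m => x i :=
  _root_.continuous_apply (A := fun _ : ℕ => Fin m) i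

/-- The shift map. -/
def shift (x : Symb m) : Symb m := fun i => x (i + 1)

theorem continuous_shift : Continuous (shift : Symb m → Symb m) :=
  continuous_pi (A := fun _ : ℕ => Fin m) fun i => continuous_apply (i + 1)

/-- The kernel `R_n (x, y) = (x_1, …, x_n, y_1, y_2, …)`. -/
def splice (n : ℕ) (p : Symb m × Symb m) : Symb m :=
  fun i => if i < n then p.1 i else p.2 (i - n)

theorem continuous_splice (n : ℕ) :
    Continuous (splice n : Symb m × Symb m → Symb m) := by
  refine continuous_pi (A := fun _ : ℕ => Fin m) fun i => ?_
  by_cases h : i < n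
  · simpa [splice, h, Function.comp_def] using (continuous_apply i).comp continuous_fst
  · simpa [splice, h, Function.comp_def] using (continuous_apply (i - n)).comp continuous_snd

end Symb

/-! ### The space of probabilities with the Monge–Kantorovich metric -/

/-- The set of Borel probabilities on the symbolic space. It is a type of its own, in order that
it carries the Monge–Kantorovich metric below. -/
def ProbSymb (m : ℕ) : Type := ProbabilityMeasure (Symb m)

namespace ProbSymb

variable {m : ℕ}

/-- The underlying probability measure. -/
def toProb (μ : ProbSymb m) : ProbabilityMeasure (Symb m) := μ

/-- The underlying measure. -/
def toMeasure (μ : ProbSymb m) : Measure (Symb m) := (toProb μ : Measure (Symb m))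

instance (μ : ProbSymb m) : IsProbabilityMeasure μ.toMeasure :=
  inferInstanceAs (IsProbabilityMeasure (toProb μ : Measure (Symb m)))

/-- The Monge–Kantorovich distance: the supremum of `∫ f dμ - ∫ f dν` over all real functions `f`
on the symbolic space with Lipschitz constant at most one. -/
def mkDist (μ ν : ProbSymb m) : ℝ :=
  ⨆ f : {f : Symb m → ℝ // LipschitzWith 1 f},
    (∫ x, f.1 x ∂μ.toMeasure - ∫ x, f.1 x ∂ν.toMeasure)

theorem integrable_of_continuous (μ : ProbSymb m) {f : Symb m → ℝ} (hf : Continuous f) :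
    Integrable f μ.toMeasure :=
  (BoundedContinuousFunction.mkOfCompact ⟨f, hf⟩).integrable μ.toMeasure

theorem nonempty_symb (μ : ProbSymb m) : Nonempty (Symb m) :=
  nonempty_of_isProbabilityMeasure μ.toMeasure

theorem abs_integral_sub_le (μ : ProbSymb m) {f : Symb m → ℝ} (hf : Continuous f) {c C : ℝ}
    (h : ∀ x, |f x - c| ≤ C) : |∫ x, f x ∂μ.toMeasure - c| ≤ C := by
  have h1 : ∫ x, f x ∂μ.toMeasure - c = ∫ x, (f x - c) ∂μ.toMeasure := by
    rw [integral_sub (integrable_of_continuous μ hf) (integrable_const c)]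
    simp
  rw [h1]
  have := norm_integral_le_of_norm_le_const (μ := μ.toMeasure) (f := fun x => f x - c) (C := C)
    (Eventually.of_forall h)
  simpa using this

theorem mkDist_bddAbove (μ ν : ProbSymb m) :
    BddAbove (Set.range fun f : {f : Symb m → ℝ // LipschitzWith 1 f} =>
      (∫ x, f.1 x ∂μ.toMeasure - ∫ x, f.1 x ∂ν.toMeasure)) := by
  obtain ⟨x₀⟩ := nonempty_symb μ
  refine ⟨2, ?_⟩
  rintro _ ⟨⟨f, hf⟩, rfl⟩
  have hb : ∀ x, |f x - f x₀| ≤ 1 := fun x => by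
    have := hf.dist_le_mul x x₀
    rw [Real.dist_eq] at this
    have h2 := Symb.dist_le_one x x₀
    simp only [NNReal.coe_one, one_mul] at this
    linarith
  have h1 := abs_le.1 (abs_integral_sub_le μ hf.continuous hb)
  have h2 := abs_le.1 (abs_integral_sub_le ν hf.continuous hb)
  show _ - _ ≤ (2 : ℝ)
  linarith [h1.2, h2.1]

theorem le_mkDist (μ ν : ProbSymb m) {f : Symb m → ℝ} (hf : LipschitzWith 1 f) :
    ∫ x, f x ∂μ.toMeasure - ∫ x, f x ∂ν.toMeasure ≤ mkDist μ ν :=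
  le_ciSup (mkDist_bddAbove μ ν) ⟨f, hf⟩

theorem mkDist_le {μ ν : ProbSymb m} {C : ℝ}
    (h : ∀ f : Symb m → ℝ, LipschitzWith 1 f →
      ∫ x, f x ∂μ.toMeasure - ∫ x, f x ∂ν.toMeasure ≤ C) : mkDist μ ν ≤ C :=
  haveI : Nonempty {f : Symb m → ℝ // LipschitzWith 1 f} :=
    ⟨⟨fun _ => 0, LipschitzWith.const' 0⟩⟩
  ciSup_le fun f => h f.1 f.2

theorem mkDist_comm_le (μ ν : ProbSymb m) : mkDist μ ν ≤ mkDist ν μ := by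
  refine mkDist_le fun f hf => ?_
  have := le_mkDist ν μ hf.neg
  simp only [Pi.neg_apply, integral_neg] at this
  linarith

theorem eq_of_mkDist_eq_zero {μ ν : ProbSymb m} (h : mkDist μ ν = 0) : μ = ν := by
  have h' : mkDist ν μ = 0 := le_antisymm (h ▸ mkDist_comm_le ν μ) (h ▸ mkDist_comm_le μ ν)
  have h1 : ∀ f : Symb m → ℝ, LipschitzWith 1 f →
      ∫ x, f x ∂μ.toMeasure = ∫ x, f x ∂ν.toMeasure := fun f hf => by
    have a := le_mkDist μ ν hf
    have b := le_mkDist ν μ hf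
    linarith
  have h2 : ∀ (K : ℝ≥0) (f : Symb m → ℝ), LipschitzWith K f →
      ∫ x, f x ∂μ.toMeasure = ∫ x, f x ∂ν.toMeasure := fun K f hf => by
    have hK : (0 : ℝ) < (K : ℝ) + 1 := by positivity
    have hl : LipschitzWith 1 fun x => ((K : ℝ) + 1)⁻¹ * f x := by
      refine LipschitzWith.of_dist_le_mul fun x y => ?_
      have hd := hf.dist_le_mul x y
      rw [Real.dist_eq] at hd ⊢
      rw [← mul_sub, abs_mul, abs_of_pos (inv_pos.2 hK), inv_mul_le_iff₀ hK]
      simp only [NNReal.coe_one, one_mul]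
      nlinarith [dist_nonneg (x := x) (y := y)]
    have := h1 _ hl
    rw [integral_const_mul, integral_const_mul] at this
    exact mul_left_cancel₀ (inv_ne_zero hK.ne') this
  have h3 : Tendsto (fun _ : ℕ => toProb μ) atTop (𝓝 (toProb ν)) :=
    tendsto_iff_forall_lipschitz_integral_tendsto.2 fun f _ ⟨L, hL⟩ => by
      have : ∫ x, f x ∂(toProb μ : Measure (Symb m)) = ∫ x, f x ∂(toProb ν : Measure (Symb m)) :=
        h2 L f hL
      rw [this]
      exact tendsto_const_nhds
  exact (tendsto_nhds_unique tendsto_const_nhds h3 : toProb μ = toProb ν)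

/-- The space of probabilities is equipped with the Monge–Kantorovich metric; its topology and its
Borel sets below are those of this metric. -/
instance : MetricSpace (ProbSymb m) where
  dist := mkDist
  dist_self μ := by
    refine le_antisymm (mkDist_le fun f _ => by simp) ?_
    simpa using le_mkDist μ μ (LipschitzWith.const' (0 : ℝ))
  dist_comm μ ν := le_antisymm (mkDist_comm_le μ ν) (mkDist_comm_le ν μ)
  dist_triangle μ ν ρ := mkDist_le fun f hf => by
    have h1 := le_mkDist μ ν hf
    have h2 := le_mkDist ν ρ hf
    linarith
  eq_of_dist_eq_zero h := eq_of_mkDist_eq_zero h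

theorem dist_def (μ ν : ProbSymb m) : dist μ ν = mkDist μ ν := rfl

instance : MeasurableSpace (ProbSymb m) := borel (ProbSymb m)

instance : BorelSpace (ProbSymb m) := ⟨rfl⟩

/-- The map sending a Borel probability, with the weak topology on its type, to itself. -/
def ofProb (μ : ProbabilityMeasure (Symb m)) : ProbSymb m := μ

/-- Indicator function of a cylinder of length `N`. -/
def cyl (N : ℕ) (a : Fin N → Fin m) (x : Symb m) : ℝ := if (fun i : Fin N => x i) = a then 1 else 0

theorem continuous_cyl (N : ℕ) (a : Fin N → Fin m) : Continuous (cyl N a) := by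
  have h1 : Continuous fun x : Symb m => (fun i : Fin N => x i) :=
    continuous_pi fun i => Symb.continuous_apply i
  have h2 : Continuous fun b : Fin N → Fin m => if b = a then (1 : ℝ) else 0 :=
    continuous_of_discreteTopology
  exact h2.comp h1

theorem mkDist_le_cyl (N : ℕ) (μ ν : ProbSymb m) :
    mkDist μ ν ≤ 2 * (1 / 2 : ℝ) ^ N +
      ∑ a : Fin N → Fin m, |∫ x, cyl N a x ∂μ.toMeasure - ∫ x, cyl N a x ∂ν.toMeasure| := by
  obtain ⟨x₀⟩ := nonempty_symb μ
  refine mkDist_le fun f hf => ?_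
  have hb : ∀ x y, |f x - f y| ≤ dist x y := fun x y => by
    simpa [Real.dist_eq] using hf.dist_le_mul x y
  let s : (Fin N → Fin m) → Symb m := fun a i => if h : i < N then a ⟨i, h⟩ else x₀ i
  let g : Symb m → ℝ := fun x => ∑ a : Fin N → Fin m, (f (s a) - f x₀) * cyl N a x
  have hg : ∀ x, g x = f (s fun i => x i) - f x₀ := fun x => by
    simp [g, cyl]
  have hgc : Continuous g :=
    continuous_finsetSum _ fun a _ => continuous_const.mul (continuous_cyl N a)
  have hgi : ∀ ρ : ProbSymb m, ∫ x, g x ∂ρ.toMeasure =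
      ∑ a : Fin N → Fin m, (f (s a) - f x₀) * ∫ x, cyl N a x ∂ρ.toMeasure := fun ρ => by
    rw [integral_finsetSum _ fun a _ =>
      (integrable_of_continuous ρ (continuous_cyl N a)).const_mul _]
    simp_rw [integral_const_mul]
  have hfg : ∀ ρ : ProbSymb m,
      |∫ x, f x ∂ρ.toMeasure - ∫ x, g x ∂ρ.toMeasure - f x₀| ≤ (1 / 2 : ℝ) ^ N := fun ρ => by
    rw [← integral_sub (integrable_of_continuous ρ hf.continuous) (integrable_of_continuous ρ hgc)]
    refine abs_integral_sub_le ρ (hf.continuous.sub hgc) fun x => ?_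
    have e : f x - g x - f x₀ = f x - f (s fun i => x i) := by rw [hg]; ring
    refine (congrArg abs e).trans_le ?_
    refine (hb _ _).trans (Symb.dist_le_pow fun i hi => ?_)
    simp [s, hi]
  have h1 := abs_le.1 (hfg μ)
  have h2 := abs_le.1 (hfg ν)
  have h3 : ∫ x, g x ∂μ.toMeasure - ∫ x, g x ∂ν.toMeasure ≤
      ∑ a : Fin N → Fin m, |∫ x, cyl N a x ∂μ.toMeasure - ∫ x, cyl N a x ∂ν.toMeasure| := by
    rw [hgi, hgi, ← Finset.sum_sub_distrib]
    refine Finset.sum_le_sum fun a _ => ?_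
    rw [← mul_sub]
    refine (le_abs_self _).trans ?_
    rw [abs_mul]
    exact mul_le_of_le_one_left (abs_nonneg _) ((hb _ _).trans (Symb.dist_le_one _ _))
  linarith [h1.2, h2.1]

theorem continuous_ofProb : Continuous (ofProb : ProbabilityMeasure (Symb m) → ProbSymb m) := by
  rw [continuous_iff_continuousAt]
  intro ν
  rw [ContinuousAt, Metric.tendsto_nhds]
  intro ε hε
  obtain ⟨N, hN⟩ := exists_pow_lt_of_lt_one (show 0 < ε / 4 by positivity)
    (show (1 / 2 : ℝ) < 1 by norm_num)
  have hc : Continuous fun μ : ProbabilityMeasure (Symb m) => ∑ a : Fin N → Fin m,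
      |∫ x, cyl N a x ∂(ofProb μ).toMeasure - ∫ x, cyl N a x ∂(ofProb ν).toMeasure| := by
    refine continuous_finsetSum _ fun a _ => ((Continuous.sub ?_ continuous_const).abs)
    exact ProbabilityMeasure.continuous_integral_continuousMap
      (⟨cyl N a, continuous_cyl N a⟩ : C(Symb m, ℝ))
  have h0 := hc.tendsto ν
  simp only [sub_self, abs_zero, Finset.sum_const_zero] at h0
  filter_upwards [h0.eventually_lt_const (show 0 < ε / 2 by positivity)] with μ hμ
  have := mkDist_le_cyl N (ofProb μ) (ofProb ν)
  rw [dist_def]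
  linarith

instance : CompactSpace (ProbSymb m) where
  isCompact_univ := by
    have h := isCompact_range (continuous_ofProb (m := m))
    have e : Set.range (ofProb : ProbabilityMeasure (Symb m) → ProbSymb m) = Set.univ :=
      Set.eq_univ_of_forall fun μ => ⟨toProb μ, rfl⟩
    rwa [e] at h

theorem continuous_toProb : Continuous (toProb : ProbSymb m → ProbabilityMeasure (Symb m)) := by
  let e : ProbabilityMeasure (Symb m) ≃ ProbSymb m := ⟨ofProb, toProb, fun _ => rfl, fun _ => rfl⟩
  exact (Continuous.homeoOfEquivCompactToT2 (f := e) continuous_ofProb).symm.continuous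

/-! ### The push-forward map, the convolutions and the maps of the iterated function system -/

/-- The push-forward map induced by the shift. -/
def pushShift (μ : ProbSymb m) : ProbSymb m :=
  ofProb ((toProb μ).map Symb.continuous_shift.measurable.aemeasurable)

/-- The product convolution `ν *_n μ`: the image of `ν × μ` under
`R_n (x, y) = (x_1, …, x_n, y_1, y_2, …)`. -/
def conv (n : ℕ) (ν μ : ProbSymb m) : ProbSymb m :=
  ofProb (((toProb ν).prod (toProb μ)).map (Symb.continuous_splice n).measurable.aemeasurable)

/-- The map `φ_ν (μ) = 𝔗(ν) *_n μ`. -/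
def ifsMap (n : ℕ) (ν μ : ProbSymb m) : ProbSymb m := conv n (pushShift ν) μ

theorem continuous_ifsMap (n : ℕ) :
    Continuous fun p : ProbSymb m × ProbSymb m => ifsMap n p.1 p.2 := by
  have h1 : Continuous fun ν : ProbSymb m => toProb (pushShift ν) :=
    (ProbabilityMeasure.continuous_map Symb.continuous_shift).comp continuous_toProb
  have h2 : Continuous fun p : ProbSymb m × ProbSymb m =>
      (toProb (pushShift p.1)).prod (toProb p.2) :=
    ProbabilityMeasure.continuous_prod.comp
      ((h1.comp continuous_fst).prodMk (continuous_toProb.comp continuous_snd))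
  exact continuous_ofProb.comp
    ((ProbabilityMeasure.continuous_map (Symb.continuous_splice n)).comp h2)

/-! ### The Ruelle operator -/

/-- The function `μ ↦ ∫ exp (A (φ_ν μ)) F (φ_ν μ) dΠ₀(ν)`. -/
def ruelleFun (n : ℕ) (A : C(ProbSymb m, ℝ)) (P : Measure (ProbSymb m))
    (F : C(ProbSymb m, ℝ)) (μ : ProbSymb m) : ℝ :=
  ∫ ν, Real.exp (A (ifsMap n ν μ)) * F (ifsMap n ν μ) ∂P

theorem continuous_integrand (n : ℕ) (A F : C(ProbSymb m, ℝ)) :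
    Continuous fun p : ProbSymb m × ProbSymb m =>
      Real.exp (A (ifsMap n p.1 p.2)) * F (ifsMap n p.1 p.2) :=
  (Real.continuous_exp.comp (A.continuous.comp (continuous_ifsMap n))).mul
    (F.continuous.comp (continuous_ifsMap n))

theorem integrable_integrand (n : ℕ) (A F : C(ProbSymb m, ℝ)) (P : Measure (ProbSymb m))
    [IsProbabilityMeasure P] (μ : ProbSymb m) :
    Integrable (fun ν => Real.exp (A (ifsMap n ν μ)) * F (ifsMap n ν μ)) P :=
  (BoundedContinuousFunction.mkOfCompact ⟨_, (continuous_integrand n A F).comp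
    (continuous_id.prodMk (continuous_const (y := μ)))⟩).integrable P

theorem abs_integrand_le (n : ℕ) (A F : C(ProbSymb m, ℝ)) (ν μ : ProbSymb m) :
    ‖Real.exp (A (ifsMap n ν μ)) * F (ifsMap n ν μ)‖ ≤ Real.exp ‖A‖ * ‖F‖ := by
  rw [norm_mul, Real.norm_eq_abs, Real.abs_exp]
  gcongr
  · exact (le_abs_self _).trans (A.norm_coe_le_norm _)
  · exact F.norm_coe_le_norm _

theorem continuous_ruelleFun (n : ℕ) (A : C(ProbSymb m, ℝ)) (P : Measure (ProbSymb m))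
    [IsProbabilityMeasure P] (F : C(ProbSymb m, ℝ)) : Continuous (ruelleFun n A P F) :=
  continuous_of_dominated
    (fun μ => (integrable_integrand n A F P μ).aestronglyMeasurable)
    (fun μ => Eventually.of_forall fun ν => abs_integrand_le n A F ν μ)
    (integrable_const _)
    (Eventually.of_forall fun ν => (continuous_integrand n A F).comp
      ((continuous_const (y := ν)).prodMk continuous_id))

/-- The Level-2 Ruelle operator `F ↦ (μ ↦ ∫ exp (A (φ_ν μ)) F (φ_ν μ) dΠ₀(ν))`, as a bounded
operator on the Banach space of continuous functions with the supremum norm. -/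
def ruelleOp (n : ℕ) (A : C(ProbSymb m, ℝ)) (P : Measure (ProbSymb m))
    [IsProbabilityMeasure P] : C(ProbSymb m, ℝ) →L[ℝ] C(ProbSymb m, ℝ) :=
  LinearMap.mkContinuous
    { toFun := fun F => ⟨ruelleFun n A P F, continuous_ruelleFun n A P F⟩
      map_add' := fun F G => by
        ext μ
        simp only [ContinuousMap.coe_mk, ContinuousMap.add_apply, ruelleFun, mul_add]
        exact integral_add (integrable_integrand n A F P μ) (integrable_integrand n A G P μ)
      map_smul' := fun c F => by
        ext μ
        simp only [ContinuousMap.coe_mk, ContinuousMap.smul_apply, ruelleFun, smul_eq_mul,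
          RingHom.id_apply]
        rw [← integral_const_mul]
        congr 1
        ext ν
        ring }
    (Real.exp ‖A‖)
    (fun F => (ContinuousMap.norm_le _ (by positivity)).2 fun μ => by
      have h := norm_integral_le_of_norm_le_const (μ := P)
        (Eventually.of_forall fun ν => abs_integrand_le n A F ν μ)
      simpa [ruelleFun] using h)

theorem ruelleOp_apply (n : ℕ) (A : C(ProbSymb m, ℝ)) (P : Measure (ProbSymb m))
    [IsProbabilityMeasure P] (F : C(ProbSymb m, ℝ)) (μ : ProbSymb m) :
    ruelleOp n A P F μ = ∫ ν, Real.exp (A (ifsMap n ν μ)) * F (ifsMap n ν μ) ∂P := rfl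

end ProbSymb

end

/-!
The operator `B = ruelleOp n A P₀` is positive on `C(ProbSymb m, ℝ)`, and each map `μ ↦ φ_ν(μ)`
contracts the Monge–Kantorovich distance by `1/2` (`ProbSymb.dist_ifsMap_le`): splicing at least one
common letter in front of two sequences halves their distance. Hence, if `u` is `K`-Lipschitz, so is
`log (B (exp u))`: the logarithm of the integrand varies by at most `(K + K) / 2` times the distance
(`ProbSymb.ruelleOp_expMap_le`).

This regularity gives a positive eigenfunction by the vanishing discount method. For `0 < s < 1` the
map `u ↦ log (B (exp (s u)))` contracts the supremum norm by `s`, so it has a fixed point, which is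
`K`-Lipschitz as a limit of iterates of `0`. Subtracting its value `c` at a base point `x₀` yields a
`K`-Lipschitz `v` with `v x₀ = 0` and `B (exp (s v)) = exp ((1 - s) c) exp v`
(`ContinuousMap.exists_discounted_eigenfunction`). Such `v` form a compact set by Arzelà–Ascoli, and
a limit point as `s → 1` satisfies `B (exp v) = r exp v`, where the convergence of the factors
`exp ((1 - s) c)` is automatic, since they are the values of `B (exp (s v))` at `x₀`
(`ContinuousMap.exists_pos_eigenfunction`).

A positive eigenfunction determines the growth rate of a positive operator: comparing a function with
multiples of `h` gives `r ^ N ≤ ‖B ^ N‖ ≤ C r ^ N`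
(`ContinuousMap.exists_norm_pow_le_of_pos_eigenfunction`). Therefore `‖B ^ N‖ ^ (1 / N)` tends to
`r`. This limit bounds the real spectral radius from above, and the eigenvalue `r` bounds it from
below.
-/

/-! ### Positive operators on continuous functions -/

namespace ContinuousMap

variable {X : Type*}

section Topological

variable [TopologicalSpace X]

/-- The exponential of a continuous real function, taken pointwise. -/
noncomputable def expMap (u : C(X, ℝ)) : C(X, ℝ) := ⟨fun x => Real.exp (u x), by fun_prop⟩

@[simp]
theorem expMap_apply (u : C(X, ℝ)) (x : X) : expMap u x = Real.exp (u x) := rfl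

theorem continuous_expMap : Continuous (expMap : C(X, ℝ) → C(X, ℝ)) :=
  continuous_postcomp ⟨Real.exp, Real.continuous_exp⟩

theorem apply_mono_of_nonneg {B : C(X, ℝ) →L[ℝ] C(X, ℝ)}
    (hB : ∀ F : C(X, ℝ), (∀ x, 0 ≤ F x) → ∀ x, 0 ≤ B F x) {F G : C(X, ℝ)}
    (h : ∀ x, F x ≤ G x) (x : X) : B F x ≤ B G x := by
  have := hB (G - F) (fun y => by simpa using h y) x
  rw [map_sub] at this
  simpa using this

/-- The discounted logarithmic operator `u ↦ log (B (exp (s u)))`. -/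
noncomputable def discountedLog (B : C(X, ℝ) →L[ℝ] C(X, ℝ))
    (hB : ∀ F : C(X, ℝ), (∀ x, 0 < F x) → ∀ x, 0 < B F x) (s : ℝ) (u : C(X, ℝ)) : C(X, ℝ) :=
  ⟨fun x => Real.log (B (expMap (s • u)) x),
    (B (expMap (s • u))).continuous.log fun x => (hB _ (fun _ => Real.exp_pos _) x).ne'⟩

theorem exp_discountedLog (B : C(X, ℝ) →L[ℝ] C(X, ℝ))
    (hB : ∀ F : C(X, ℝ), (∀ x, 0 < F x) → ∀ x, 0 < B F x) (s : ℝ) (u : C(X, ℝ)) (x : X) :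
    Real.exp (discountedLog B hB s u x) = B (expMap (s • u)) x :=
  Real.exp_log (hB _ (fun _ => Real.exp_pos _) x)

theorem discountedLog_le_add [CompactSpace X] {B : C(X, ℝ) →L[ℝ] C(X, ℝ)}
    (hB : ∀ F : C(X, ℝ), (∀ x, 0 < F x) → ∀ x, 0 < B F x)
    (hB' : ∀ F : C(X, ℝ), (∀ x, 0 ≤ F x) → ∀ x, 0 ≤ B F x) {s : ℝ} (hs : 0 ≤ s)
    (u v : C(X, ℝ)) (x : X) :
    discountedLog B hB s u x ≤ discountedLog B hB s v x + s * ‖u - v‖ := by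
  rw [← Real.exp_le_exp, Real.exp_add, exp_discountedLog, exp_discountedLog]
  have h := apply_mono_of_nonneg hB' (F := expMap (s • u))
    (G := Real.exp (s * ‖u - v‖) • expMap (s • v)) (fun y => by
      simp only [expMap_apply, smul_apply, smul_eq_mul, ← Real.exp_add]
      rw [Real.exp_le_exp]
      have h1 : u y - v y ≤ ‖u - v‖ :=
        (le_abs_self _).trans ((u - v).norm_coe_le_norm y)
      nlinarith) x
  rw [map_smul] at h
  simpa [mul_comm] using h

theorem contractingWith_discountedLog [CompactSpace X] {B : C(X, ℝ) →L[ℝ] C(X, ℝ)}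
    (hB : ∀ F : C(X, ℝ), (∀ x, 0 < F x) → ∀ x, 0 < B F x)
    (hB' : ∀ F : C(X, ℝ), (∀ x, 0 ≤ F x) → ∀ x, 0 ≤ B F x) {s : ℝ≥0} (hs : s < 1) :
    ContractingWith s (discountedLog B hB s) := by
  refine ⟨hs, LipschitzWith.of_dist_le_mul fun u v => ?_⟩
  rw [dist_le (by positivity)]
  intro x
  rw [Real.dist_eq, abs_sub_le_iff]
  have h1 := discountedLog_le_add hB hB' s.coe_nonneg u v x
  have h2 := discountedLog_le_add hB hB' s.coe_nonneg v u x
  rw [← dist_eq_norm] at h1 h2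
  rw [dist_comm v u] at h2
  constructor <;> linarith

end Topological

/-! ### A positive eigenfunction by vanishing discount -/

section Metric

variable [MetricSpace X]

theorem isClosed_setOf_lipschitzWith (K : ℝ≥0) :
    IsClosed {u : C(X, ℝ) | LipschitzWith K u} := by
  have : {u : C(X, ℝ) | LipschitzWith K u} =
      ⋂ x, ⋂ y, {u : C(X, ℝ) | dist (u x) (u y) ≤ K * dist x y} := by
    ext u
    simp [lipschitzWith_iff_dist_le_mul]
  rw [this]
  exact isClosed_iInter fun x => isClosed_iInter fun y =>
    isClosed_le ((continuous_eval_const x).dist (continuous_eval_const y)) continuous_const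

/-- Arzelà–Ascoli for the normalized `K`-Lipschitz functions. -/
theorem isCompact_setOf_lipschitzWith_eq_zero (K : ℝ≥0) (x₀ : X) :
    IsCompact {u : C(X, ℝ) | LipschitzWith K u ∧ u x₀ = 0} := by
  refine ArzelaAscoli.isCompact_of_equicontinuous _ ?_ ?_
  · have e : ContinuousMap.toFun '' {u : C(X, ℝ) | LipschitzWith K u ∧ u x₀ = 0} =
        (⋂ x, ⋂ y, {f : X → ℝ | dist (f x) (f y) ≤ K * dist x y}) ∩ {f | f x₀ = 0} := by
      ext f
      simp only [Set.mem_image, Set.mem_ofPred_eq, Set.mem_inter_iff, Set.mem_iInter]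
      constructor
      · rintro ⟨u, ⟨h1, h2⟩, rfl⟩
        exact ⟨fun x y => h1.dist_le_mul x y, h2⟩
      · rintro ⟨h1, h2⟩
        have h := LipschitzWith.of_dist_le_mul h1
        exact ⟨⟨f, h.continuous⟩, ⟨h, h2⟩, rfl⟩
    rw [e]
    refine IsCompact.of_isClosed_subset
      (isCompact_univ_pi fun x : X => isCompact_closedBall (0 : ℝ) (K * dist x x₀)) ?_ ?_
    · refine IsClosed.inter (isClosed_iInter fun x => isClosed_iInter fun y =>
        isClosed_le ((continuous_apply x).dist (continuous_apply y)) continuous_const) ?_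
      exact isClosed_eq (continuous_apply x₀) continuous_const
    · rintro f ⟨h1, h2⟩ x -
      simp only [Set.mem_iInter, Set.mem_ofPred_eq] at h1 h2
      rw [Metric.mem_closedBall, ← h2]
      exact h1 x x₀
  · exact (LipschitzWith.uniformEquicontinuous _ K fun u => u.2.1).equicontinuous

variable [CompactSpace X] {B : C(X, ℝ) →L[ℝ] C(X, ℝ)} {K : ℝ≥0}

theorem exists_discounted_eigenfunction
    (hB : ∀ F : C(X, ℝ), (∀ x, 0 < F x) → ∀ x, 0 < B F x)
    (hB' : ∀ F : C(X, ℝ), (∀ x, 0 ≤ F x) → ∀ x, 0 ≤ B F x)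
    (hK : ∀ u : C(X, ℝ), LipschitzWith K u → ∀ x y,
      B (expMap u) x ≤ Real.exp (K * dist x y) * B (expMap u) y)
    (x₀ : X) {s : ℝ≥0} (hs : s < 1) :
    ∃ (v : C(X, ℝ)) (c : ℝ), LipschitzWith K v ∧ v x₀ = 0 ∧
      B (expMap ((s : ℝ) • v)) = Real.exp ((1 - s) * c) • expMap v := by
  have hc := contractingWith_discountedLog hB hB' hs
  have hinv : ∀ u : C(X, ℝ), LipschitzWith K u → LipschitzWith K (discountedLog B hB s u) := by
    intro u hu
    have hsu : LipschitzWith K ((s : ℝ) • u : C(X, ℝ)) := by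
      refine LipschitzWith.of_dist_le_mul fun x y => ?_
      have h := hu.dist_le_mul x y
      have h1 : (s : ℝ) ≤ 1 := by exact_mod_cast hs.le
      simp only [smul_apply, smul_eq_mul, Real.dist_eq, ← mul_sub, abs_mul, NNReal.abs_eq] at h ⊢
      exact (mul_le_of_le_one_left (abs_nonneg _) h1).trans h
    have key : ∀ x y, discountedLog B hB s u x ≤ K * dist x y + discountedLog B hB s u y := by
      intro x y
      rw [← Real.exp_le_exp, Real.exp_add, exp_discountedLog, exp_discountedLog]
      exact hK _ hsu x y
    refine LipschitzWith.of_dist_le_mul fun x y => ?_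
    rw [Real.dist_eq, abs_sub_le_iff]
    have h1 := key x y
    have h2 := key y x
    rw [dist_comm y x] at h2
    constructor <;> linarith
  let u := hc.fixedPoint
  have hfix : discountedLog B hB s u = u := hc.fixedPoint_isFixedPt
  have hit : ∀ k, LipschitzWith K ((discountedLog B hB s)^[k] 0) := by
    intro k
    induction k with
    | zero => exact LipschitzWith.const' (0 : ℝ)
    | succ k ih =>
      rw [Function.iterate_succ_apply']
      exact hinv _ ih
  have hu : LipschitzWith K u :=
    (isClosed_setOf_lipschitzWith K).mem_of_tendsto (hc.tendsto_iterate_fixedPoint 0)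
      (Eventually.of_forall hit)
  refine ⟨u - const X (u x₀), u x₀, LipschitzWith.of_dist_le_mul fun x y => ?_, by simp, ?_⟩
  · simpa using hu.dist_le_mul x y
  · have e : expMap ((s : ℝ) • (u - const X (u x₀))) =
        Real.exp (-(s * u x₀)) • expMap ((s : ℝ) • u) := by
      ext x
      simp only [expMap_apply, smul_apply, sub_apply, const_apply, smul_eq_mul, ← Real.exp_add]
      ring_nf
    ext x
    rw [e, map_smul, smul_apply, ← exp_discountedLog B hB s u, hfix]
    simp only [smul_apply, expMap_apply, sub_apply, const_apply, smul_eq_mul, ← Real.exp_add]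
    ring_nf

/-- A strictly positive operator for which `u ↦ log (B (exp u))` preserves the `K`-Lipschitz
functions has a positive eigenfunction. -/
theorem exists_pos_eigenfunction [Nonempty X]
    (hB : ∀ F : C(X, ℝ), (∀ x, 0 < F x) → ∀ x, 0 < B F x)
    (hB' : ∀ F : C(X, ℝ), (∀ x, 0 ≤ F x) → ∀ x, 0 ≤ B F x)
    (hK : ∀ u : C(X, ℝ), LipschitzWith K u → ∀ x y,
      B (expMap u) x ≤ Real.exp (K * dist x y) * B (expMap u) y) :
    ∃ (h : C(X, ℝ)) (r : ℝ), (∀ x, 0 < h x) ∧ 0 < r ∧ B h = r • h := by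
  obtain ⟨x₀⟩ := ‹Nonempty X›
  obtain ⟨s, -, hs1, hs⟩ := exists_seq_strictMono_tendsto' (show (0 : ℝ≥0) < 1 by simp)
  choose v c hvK hv0 hv using fun k => exists_discounted_eigenfunction hB hB' hK x₀ (hs1 k).2
  obtain ⟨w, hw, φ, hφ, hlim⟩ := (isCompact_setOf_lipschitzWith_eq_zero K x₀).tendsto_subseq
    (x := v) fun k => ⟨hvK k, hv0 k⟩
  have hs' : Tendsto (fun k => ((s (φ k) : ℝ≥0) : ℝ)) atTop (𝓝 1) := by
    exact_mod_cast (NNReal.tendsto_coe.2 hs).comp hφ.tendsto_atTop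
  have hl : Tendsto (fun k => B (expMap ((s (φ k) : ℝ) • v (φ k)))) atTop (𝓝 (B (expMap w))) := by
    have := hs'.smul hlim
    rw [one_smul] at this
    exact ((B.continuous.comp continuous_expMap).tendsto w).comp this
  have hl' : ∀ x, Tendsto (fun k => B (expMap ((s (φ k) : ℝ) • v (φ k))) x) atTop
      (𝓝 (B (expMap w) x)) := fun x => ((continuous_eval_const x).tendsto _).comp hl
  refine ⟨expMap w, B (expMap w) x₀, fun x => Real.exp_pos _, hB _ (fun x => Real.exp_pos _) _, ?_⟩
  ext x
  refine tendsto_nhds_unique (hl' x) ?_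
  have hx : Tendsto (fun k => expMap (v (φ k)) x) atTop (𝓝 (expMap w x)) :=
    (((continuous_eval_const x).comp continuous_expMap).tendsto w).comp hlim
  refine ((hl' x₀).mul hx).congr fun k => ?_
  rw [hv]
  simp [hv0]

end Metric

/-! ### The growth rate and the spectral radius -/

section SpectralRadius

variable [TopologicalSpace X] {B : C(X, ℝ) →L[ℝ] C(X, ℝ)} {h : C(X, ℝ)} {r : ℝ}

theorem pow_apply_eigenfunction (hr : B h = r • h) (N : ℕ) : (B ^ N) h = r ^ N • h := by
  induction N with
  | zero => simp
  | succ N ih => rw [pow_succ, mul_apply_eq_comp, hr, map_smul, ih, smul_smul, pow_succ,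
      mul_comm]

theorem mem_spectrum_of_eigenfunction (hne : h ≠ 0) (hr : B h = r • h) : r ∈ spectrum ℝ B := by
  rw [spectrum.mem_iff]
  rintro ⟨U, hU⟩
  have h0 : (U : C(X, ℝ) →L[ℝ] C(X, ℝ)) h = 0 := by
    rw [hU, _root_.sub_apply, hr, Algebra.algebraMap_eq_smul_one]
    simp
  have h1 := congrArg (fun T : C(X, ℝ) →L[ℝ] C(X, ℝ) => T h) U.inv_mul
  simp only [mul_apply_eq_comp, h0, map_zero, one_apply_eq_self] at h1
  exact hne h1.symm

variable [CompactSpace X]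

theorem exists_norm_pow_le_of_pos_eigenfunction [Nonempty X]
    (hB : ∀ F : C(X, ℝ), (∀ x, 0 ≤ F x) → ∀ x, 0 ≤ B F x) (hh : ∀ x, 0 < h x) (h0 : 0 ≤ r)
    (hr : B h = r • h) : ∃ C : ℝ, 0 < C ∧ ∀ N, ‖B ^ N‖ ≤ C * r ^ N := by
  obtain ⟨x₁, -, hx₁⟩ := isCompact_univ.exists_isMinOn Set.univ_nonempty h.continuous.continuousOn
  have hmin : ∀ x, h x₁ ≤ h x := fun x => hx₁ (Set.mem_univ x)
  have hpow : ∀ N, ∀ F : C(X, ℝ), (∀ x, 0 ≤ F x) → ∀ x, 0 ≤ (B ^ N) F x := by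
    intro N
    induction N with
    | zero => intro F hF x; simpa using hF x
    | succ N ih =>
      intro F hF x
      rw [pow_succ, mul_apply_eq_comp]
      exact ih _ (hB F hF) x
  have hnorm : 0 < ‖h‖ := norm_pos_iff.2 fun e => (hh x₁).ne' (by simp [e])
  refine ⟨‖h‖ / h x₁, div_pos hnorm (hh x₁), fun N => ?_⟩
  have hC : 0 ≤ ‖h‖ / h x₁ * r ^ N := by have := hh x₁; positivity
  refine ContinuousLinearMap.opNorm_le_bound _ hC fun F => ?_
  -- The domination `F ≤ (‖F‖ / min h) h` is preserved by `B ^ N`.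
  have key : ∀ G : C(X, ℝ), ‖G‖ = ‖F‖ → ∀ x, (B ^ N) G x ≤ ‖h‖ / h x₁ * r ^ N * ‖F‖ := by
    intro G hG x
    have h1 := apply_mono_of_nonneg (hpow N) (F := G) (G := (‖F‖ / h x₁) • h) (fun y => by
      have h2 : G y ≤ ‖F‖ := hG ▸ (le_abs_self _).trans (G.norm_coe_le_norm y)
      rw [smul_apply, smul_eq_mul, div_mul_eq_mul_div, le_div_iff₀ (hh x₁)]
      exact (mul_le_mul_of_nonneg_right h2 (hh x₁).le).trans
        (mul_le_mul_of_nonneg_left (hmin y) (norm_nonneg _))) x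
    rw [map_smul, pow_apply_eigenfunction hr] at h1
    have h3 : h x ≤ ‖h‖ := (le_abs_self _).trans (h.norm_coe_le_norm x)
    have hp : 0 ≤ ‖F‖ / h x₁ * r ^ N := by have := hh x₁; positivity
    calc (B ^ N) G x ≤ ‖F‖ / h x₁ * r ^ N * h x := by
          simpa [mul_assoc] using h1
      _ ≤ ‖F‖ / h x₁ * r ^ N * ‖h‖ := mul_le_mul_of_nonneg_left h3 hp
      _ = ‖h‖ / h x₁ * r ^ N * ‖F‖ := by ring
  refine (norm_le _ (by positivity)).2 fun x => abs_le.2 ⟨?_, key F rfl x⟩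
  have := key (-F) (norm_neg F) x
  rw [map_neg, neg_apply] at this
  linarith

theorem pow_le_norm_pow_of_eigenfunction [Nonempty X] (hh : ∀ x, 0 < h x) (h0 : 0 ≤ r)
    (hr : B h = r • h) (N : ℕ) : r ^ N ≤ ‖B ^ N‖ := by
  obtain ⟨x⟩ := ‹Nonempty X›
  have hnorm : 0 < ‖h‖ := norm_pos_iff.2 fun e => (hh x).ne' (by simp [e])
  have h1 := (B ^ N).le_opNorm h
  rw [pow_apply_eigenfunction hr, norm_smul, Real.norm_of_nonneg (by positivity)] at h1
  exact le_of_mul_le_mul_right h1 hnorm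

theorem tendsto_norm_pow_of_pos_eigenfunction [Nonempty X]
    (hB : ∀ F : C(X, ℝ), (∀ x, 0 ≤ F x) → ∀ x, 0 ≤ B F x) (hh : ∀ x, 0 < h x) (h0 : 0 ≤ r)
    (hr : B h = r • h) : Tendsto (fun N : ℕ => ‖B ^ N‖ ^ (1 / (N : ℝ))) atTop (𝓝 r) := by
  obtain ⟨C, hC, hle⟩ := exists_norm_pow_le_of_pos_eigenfunction hB hh h0 hr
  have hroot : ∀ N : ℕ, N ≠ 0 → (r ^ N) ^ (1 / (N : ℝ)) = r := fun N hN => by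
    rw [one_div]
    exact Real.pow_rpow_inv_natCast h0 hN
  have hC1 : Tendsto (fun N : ℕ => C ^ (1 / (N : ℝ)) * r) atTop (𝓝 r) := by
    have := (Real.continuousAt_const_rpow hC.ne' (b := 0)).tendsto.comp
      tendsto_one_div_atTop_nhds_zero_nat
    simpa using this.mul_const r
  refine tendsto_of_tendsto_of_tendsto_of_le_of_le' tendsto_const_nhds hC1 ?_ ?_
  · filter_upwards [eventually_ne_atTop 0] with N hN
    have := Real.rpow_le_rpow (by positivity) (pow_le_norm_pow_of_eigenfunction hh h0 hr N)
      (show 0 ≤ 1 / (N : ℝ) by positivity)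
    rwa [hroot N hN] at this
  · filter_upwards [eventually_ne_atTop 0] with N hN
    have := Real.rpow_le_rpow (B ^ N).opNorm_nonneg (hle N) (show 0 ≤ 1 / (N : ℝ) by positivity)
    rwa [Real.mul_rpow hC.le (by positivity), hroot N hN] at this

theorem spectralRadius_eq_of_pos_eigenfunction [Nonempty X]
    (hB : ∀ F : C(X, ℝ), (∀ x, 0 ≤ F x) → ∀ x, 0 ≤ B F x) (hh : ∀ x, 0 < h x) (h0 : 0 ≤ r)
    (hr : B h = r • h) : spectralRadius ℝ B = ENNReal.ofReal r := by
  obtain ⟨x⟩ := ‹Nonempty X›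
  refine le_antisymm ?_ ?_
  · refine (spectrum.spectralRadius_le_liminf_pow_nnnorm_pow_one_div ℝ B).trans_eq ?_
    refine Tendsto.liminf_eq ?_
    refine (ENNReal.tendsto_ofReal (tendsto_norm_pow_of_pos_eigenfunction hB hh h0 hr)).congr
      fun N => ?_
    rw [← ENNReal.ofReal_rpow_of_nonneg (B ^ N).opNorm_nonneg (by positivity)]
    exact congrArg (· ^ (1 / (N : ℝ))) (ofReal_norm (B ^ N))
  · have hmem := mem_spectrum_of_eigenfunction (fun e => (hh x).ne' (by simp [e])) hr
    refine le_trans (le_of_eq ?_) (le_iSup₂ (f := fun k (_ : k ∈ spectrum ℝ B) => (‖k‖₊ : ℝ≥0∞))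
      r hmem)
    rw [← Real.enorm_of_nonneg h0]
    rfl

end SpectralRadius

end ContinuousMap

/-! ### The Ruelle operator of the iterated function system -/

namespace Symb

variable {m : ℕ}

theorem dist_le_pow_succ {x y : Symb m} {N : ℕ} (h : ∀ i < N, x i = y i) :
    dist x y ≤ (1 / 2 : ℝ) ^ (N + 1) := by
  rw [dist_def, symbDist_eq, pow_succ]
  have := PiNat.mem_cylinder_iff_dist_le (E := fun _ => Fin m) (x := y) (y := x) (n := N) |>.1 h
  linarith

theorem dist_splice_le {n : ℕ} (hn : 1 ≤ n) (x y z : Symb m) :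
    dist (splice n (x, y)) (splice n (x, z)) ≤ 1 / 2 * dist y z := by
  by_cases hyz : y = z
  · simp [hyz]
  have hd : dist y z = (1 / 2 : ℝ) ^ (sInf {i : ℕ | y i ≠ z i} + 1) := by
    simp [dist_def, symbDist, hyz]
  rw [hd, ← pow_succ']
  refine dist_le_pow_succ fun i hi => ?_
  simp only [splice]
  split_ifs with h
  · rfl
  · by_contra hne
    have := Nat.sInf_le (s := {i : ℕ | y i ≠ z i}) hne
    omega

end Symb

namespace ProbSymb

variable {m : ℕ}

theorem integral_conv (n : ℕ) (ν μ : ProbSymb m) {f : Symb m → ℝ} (hf : Continuous f) :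
    ∫ x, f x ∂(conv n ν μ).toMeasure =
      ∫ x, ∫ y, f (Symb.splice n (x, y)) ∂μ.toMeasure ∂ν.toMeasure := by
  have hc := hf.comp (Symb.continuous_splice (m := m) n)
  have hi : Integrable (fun p : Symb m × Symb m => f (Symb.splice n p))
      (ν.toMeasure.prod μ.toMeasure) :=
    (BoundedContinuousFunction.mkOfCompact ⟨_, hc⟩).integrable _
  rw [← integral_prod _ hi]
  exact integral_map (Symb.continuous_splice n).measurable.aemeasurable
    hf.measurable.aestronglyMeasurable

theorem dist_conv_le {n : ℕ} (hn : 1 ≤ n) (ν μ μ' : ProbSymb m) :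
    dist (conv n ν μ) (conv n ν μ') ≤ 1 / 2 * dist μ μ' := by
  refine mkDist_le fun f hf => ?_
  have hc := hf.continuous.comp (Symb.continuous_splice (m := m) n)
  have hi : ∀ ρ : ProbSymb m, Integrable
      (fun x => ∫ y, f (Symb.splice n (x, y)) ∂ρ.toMeasure) ν.toMeasure := fun ρ =>
    Integrable.integral_prod_left (f := fun p : Symb m × Symb m => f (Symb.splice n p))
      ((BoundedContinuousFunction.mkOfCompact ⟨_, hc⟩).integrable (ν.toMeasure.prod ρ.toMeasure))
  rw [integral_conv n ν μ hf.continuous, integral_conv n ν μ' hf.continuous,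
    ← integral_sub (hi μ) (hi μ')]
  have key : ∀ x, ∫ y, f (Symb.splice n (x, y)) ∂μ.toMeasure -
      ∫ y, f (Symb.splice n (x, y)) ∂μ'.toMeasure ≤ 1 / 2 * dist μ μ' := by
    intro x
    have hl : LipschitzWith 1 fun y => 2 * f (Symb.splice n (x, y)) := by
      refine LipschitzWith.of_dist_le_mul fun y z => ?_
      have h1 := hf.dist_le_mul (Symb.splice n (x, y)) (Symb.splice n (x, z))
      have h2 := Symb.dist_splice_le hn x y z
      rw [Real.dist_eq] at h1 ⊢
      rw [← mul_sub, abs_mul, abs_two]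
      simp only [NNReal.coe_one, one_mul] at h1 ⊢
      linarith
    have := le_mkDist μ μ' hl
    rw [integral_const_mul, integral_const_mul, ← dist_def] at this
    linarith
  have := integral_mono ((hi μ).sub (hi μ')) (integrable_const (1 / 2 * dist μ μ')) key
  simpa using this

theorem dist_ifsMap_le {n : ℕ} (hn : 1 ≤ n) (ν μ μ' : ProbSymb m) :
    dist (ifsMap n ν μ) (ifsMap n ν μ') ≤ 1 / 2 * dist μ μ' :=
  dist_conv_le hn (pushShift ν) μ μ'

variable (n : ℕ) (A : C(ProbSymb m, ℝ)) (P : Measure (ProbSymb m)) [IsProbabilityMeasure P]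

theorem ruelleOp_nonneg (F : C(ProbSymb m, ℝ)) (hF : ∀ μ, 0 ≤ F μ) (μ : ProbSymb m) :
    0 ≤ ruelleOp n A P F μ := by
  rw [ruelleOp_apply]
  exact integral_nonneg fun ν => mul_nonneg (Real.exp_pos _).le (hF _)

theorem ruelleOp_pos (F : C(ProbSymb m, ℝ)) (hF : ∀ μ, 0 < F μ) (μ : ProbSymb m) :
    0 < ruelleOp n A P F μ := by
  have hp : ∀ ν, 0 < Real.exp (A (ifsMap n ν μ)) * F (ifsMap n ν μ) := fun ν =>
    mul_pos (Real.exp_pos _) (hF _)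
  rw [ruelleOp_apply, integral_pos_iff_support_of_nonneg (fun ν => (hp ν).le)
    (integrable_integrand n A F P μ)]
  rw [show Function.support _ = Set.univ from Set.eq_univ_of_forall fun ν => (hp ν).ne']
  simp

variable {n A}

/-- The constant `K` is reproduced: the exponent `A + u` is `2K`-Lipschitz, and the maps of the
iterated function system contract by `1/2`. -/
theorem ruelleOp_expMap_le (hn : 1 ≤ n) {K : ℝ≥0} (hA : LipschitzWith K A) (u : C(ProbSymb m, ℝ))
    (hu : LipschitzWith K u) (μ μ' : ProbSymb m) :
    ruelleOp n A P (ContinuousMap.expMap u) μ ≤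
      Real.exp (K * dist μ μ') * ruelleOp n A P (ContinuousMap.expMap u) μ' := by
  rw [ruelleOp_apply, ruelleOp_apply, ← integral_const_mul]
  refine integral_mono (integrable_integrand n A _ P μ)
    ((integrable_integrand n A _ P μ').const_mul _) fun ν => ?_
  simp only [ContinuousMap.expMap_apply, ← Real.exp_add]
  rw [Real.exp_le_exp]
  have h1 := (le_abs_self _).trans (hA.dist_le_mul (ifsMap n ν μ) (ifsMap n ν μ'))
  have h2 := (le_abs_self _).trans (hu.dist_le_mul (ifsMap n ν μ) (ifsMap n ν μ'))
  have h3 := mul_le_mul_of_nonneg_left (dist_ifsMap_le hn ν μ μ') K.coe_nonneg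
  linarith

end ProbSymb

theorem theorem1 (m n : ℕ) (hn : 1 ≤ n) (A : C(ProbSymb m, ℝ)) (K : ℝ≥0) (hA : LipschitzWith K A)
    (P₀ : Measure (ProbSymb m)) [IsProbabilityMeasure P₀] :
    ∃ (h : C(ProbSymb m, ℝ)) (r : ℝ),
      (∀ μ, 0 < h μ) ∧ 0 < r ∧
      ProbSymb.ruelleOp n A P₀ h = r • h ∧
      spectralRadius ℝ (ProbSymb.ruelleOp n A P₀) = ENNReal.ofReal r ∧
      Tendsto (fun N : ℕ => ‖ProbSymb.ruelleOp n A P₀ ^ N‖ ^ (1 / (N : ℝ))) atTop (𝓝 r) := by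
  have : Nonempty (ProbSymb m) := nonempty_of_isProbabilityMeasure P₀
  have hB := ProbSymb.ruelleOp_nonneg n A P₀
  obtain ⟨h, r, hh, hr, he⟩ := ContinuousMap.exists_pos_eigenfunction
    (ProbSymb.ruelleOp_pos n A P₀) hB (ProbSymb.ruelleOp_expMap_le P₀ hn hA)
  exact ⟨h, r, hh, hr, he, ContinuousMap.spectralRadius_eq_of_pos_eigenfunction hB hh hr.le he,
    ContinuousMap.tendsto_norm_pow_of_pos_eigenfunction hB hh hr.le he⟩
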